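/- **Double Representer Theorem.** Let $\mathcal X$ be a set, $\mathcal Y$ a real Hilbert space, $n\ge 1$, $(x_i,y_i)_{i\le n}\in(\mathcal X\times\mathcal Y)^n$, $\mathsf Y=\mathrm{span}(y_i,\ i\le n)$ and $\Lambda>0$. Let $\mathcal K:\mathcal X\times\mathcal X\to\mathcal L(\mathcal Y)$ be an operator-valued kernel, i.e. $\mathcal K(x,x')=\mathcal K(x',x)^{\#}$ (adjoint) and $\sum_{i,j\le m}\langle v_i,\mathcal K(s_i,s_j)v_j\rangle\ge 0$ for all finite families $(s_i,v_i)_{i\le m}$ in $\mathcal X\times\mathcal Y$, and let $\mathcal H_{\mathcal K}$ be its vector-valued reproducing kernel Hilbert space. Let $\ell:\mathcal Y\times\mathcal Y\to\mathbb R$ be a loss such that each $\ell_i=\ell(\cdot,y_i)$ is convex and lower semicontinuous, with Fenchel–Legendre transform $\ell_i^\star(\alpha)=\sup_{u\in\mathcal Y}\langle\alpha,u\rangle-\ell_i(u)\in\mathbb R\cup\{+\infty\}$. Let $K^Y=(\langle y_i,y_j\rangle)_{i,j}$ be the output Gram matrix. Assume that * (FL$_1$) $\ell_i^\star(a)\le\ell_i^\star(a+b)$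 for all $i\le n$, $a\in\mathsf Y$, $b\in\mathsf Y^\perp$; * (FL$_2$) for each $i\le n$, $L_i:\mathbb R^n\times\mathbb R^{n\times n}\to[-\infty,+\infty]$ is a function with $\ell_i^\star(-\sum_j\omega_jy_j)=L_i(\omega,K^Y)$ for all $\omega\in\mathbb R^n$; * $\mathcal K(x_i,x_j)\mathsf Y\subset\mathsf Y$ for all $i,j\le n$. Let $M_{ijkl}=\langle y_k,\mathcal K(x_i,x_j)y_l\rangle$ and let $\tilde M$ be the $n^2\times n^2$ block matrix whose block $(i,j)$ is the $n\times n$ matrix with entries $\tilde M^{(i,j)}_{st}=\langle y_j,\mathcal K(x_i,x_s)y_t\rangle=M_{isjt}$. 1. The problem $\min_{h\in\mathcal H_{\mathcal K}}\frac1n\sum_{i=1}^n\ell(h(x_i),y_i)+\frac\Lambda2\|h\|_{\mathcal H_{\mathcal K}}^2$ has exactly one solution $\hat h$. The problem $$\min_{\Omega\in\mathbb R^{n\times n}}\ \sum_{i=1}^nL_i(\Omega_{i:},K^Y)+\frac1{2\Lambda n}\mathrm{Tr}\big(\tilde M^\top(\Omega\otimes\Omega)\big)\qquad(\ast)$$ has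 a solution, at which its value is finite, and every solution $\hat\Omega=[\hat\omega_{ij}]$ of $(\ast)$ satisfies $$\hat h=\frac1{\Lambda n}\sum_{i,j=1}^n\mathcal K(\cdot,x_i)\,\hat\omega_{ij}\,y_j .$$ 2. If moreover $\mathcal K(x,x')=\sum_{t=1}^Tk_t(x,x')A_t$ for all $x,x'\in\mathcal X$, with $T\ge1$, positive semi-definite scalar kernels $k_t$ and positive semi-definite $A_t\in\mathcal L(\mathcal Y)$, then with $[K^X_t]_{ij}=k_t(x_i,x_j)$ and $[K^Y_t]_{ij}=\langle y_i,A_ty_j\rangle$ one has $M_{ijkl}=\sum_t[K^X_t]_{ij}[K^Y_t]_{kl}$, and the objective of $(\ast)$ equals, for every $\Omega$, $$\sum_{i=1}^nL_i(\Omega_{i:},K^Y)+\frac1{2\Lambda n}\sum_{t=1}^T\mathrm{Tr}\big(K^X_t\,\Omega\,K^Y_t\,\Omega^\top\big).$$ -/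

import Mathlib

open scoped Kronecker

noncomputable section

namespace OVK

variable {X Y : Type*} [NormedAddCommGroup Y] [InnerProductSpace ℝ Y]

/-- Operator-valued kernel `K : X × X → 𝓛(Y)`: Hermitian symmetric and positive. -/
structure IsOVK [CompleteSpace Y] (K : X → X → Y →L[ℝ] Y) : Prop where
  symm : ∀ s t, K s t = ContinuousLinearMap.adjoint (K t s)
  nonneg : ∀ (m : ℕ) (s : Fin m → X) (v : Fin m → Y),
    0 ≤ ∑ i, ∑ j, inner ℝ (v i) (K (s i) (s j) (v j))

/-- Positive semi-definite scalar kernel. -/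
structure IsScalarKernel (k : X → X → ℝ) : Prop where
  symm : ∀ s t, k s t = k t s
  nonneg : ∀ (m : ℕ) (s : Fin m → X) (c : Fin m → ℝ),
    0 ≤ ∑ i, ∑ j, c i * c j * k (s i) (s j)

/-- `K = ∑ₜ kₜ Aₜ`, with at least one term, scalar kernels `kₜ` and positive semi-definite
bounded operators `Aₜ`. -/
structure IsSumOfSeparable (K : X → X → Y →L[ℝ] Y) {T : ℕ} (k : Fin T → X → X → ℝ)
    (A : Fin T → Y →L[ℝ] Y) : Prop where
  one_le : 1 ≤ T
  kernel : ∀ t, IsScalarKernel (k t)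
  pos : ∀ t, (A t).IsPositive
  eq_sum : ∀ s s', K s s' = ∑ t, k t s s' • A t

/-- Fenchel–Legendre transform `f⋆(α) = sup_u ⟨α, u⟩ - f u`, with values in the extended reals
(never `-∞`, as `f` is real-valued, but possibly `+∞`). -/
def fenchel (f : Y → ℝ) (α : Y) : EReal :=
  ⨆ u : Y, ((inner ℝ α u - f u : ℝ) : EReal)

variable {n : ℕ}

/-- The span of the outputs `y₁, …, yₙ`. -/
def outSpan (y : Fin n → Y) : Submodule ℝ Y := Submodule.span ℝ (Set.range y)

/-- Adding a component orthogonal to the outputs does not decrease the Fenchel–Legendre transform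
of any of the functions `ℓ(·, yᵢ)`. -/
def FL1 (l : Y → Y → ℝ) (y : Fin n → Y) : Prop :=
  ∀ i, ∀ a ∈ outSpan y, ∀ b ∈ (outSpan y)ᗮ,
    fenchel (fun u => l u (y i)) a ≤ fenchel (fun u => l u (y i)) (a + b)

/-- On the span of the outputs, the Fenchel–Legendre transforms are expressed by the functions
`L i` of the coefficients and the output Gram matrix. -/
def FL2 (l : Y → Y → ℝ) (y : Fin n → Y)
    (L : Fin n → (Fin n → ℝ) → Matrix (Fin n) (Fin n) ℝ → EReal) : Prop :=
  ∀ i, ∀ w : Fin n → ℝ,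
    fenchel (fun u => l u (y i)) (-∑ j, w j • y j) = L i w (Matrix.gram ℝ y)

/-- The span of the outputs is invariant under all the operators `K(xᵢ, xⱼ)`. -/
def LeavesSpanInvariant (K : X → X → Y →L[ℝ] Y) (x : Fin n → X) (y : Fin n → Y) : Prop :=
  ∀ i j, ∀ v ∈ outSpan y, K (x i) (x j) v ∈ outSpan y

/-- The regularized empirical risk on the vv-RKHS `H`. -/
def primalObj {H : Type*} [NormedAddCommGroup H] [InnerProductSpace ℝ H] [RKHS ℝ H X Y]
    (l : Y → Y → ℝ) (lam : ℝ) (x : Fin n → X) (y : Fin n → Y) (h : H) : ℝ :=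
  1 / (n : ℝ) * ∑ i, l (h (x i)) (y i) + lam / 2 * ‖h‖ ^ 2

/-- The tensor `M i j k l = ⟨y k, K (x i) (x j) (y l)⟩`. -/
def tensorM (K : X → X → Y →L[ℝ] Y) (x : Fin n → X) (y : Fin n → Y) (i j k l : Fin n) : ℝ :=
  inner ℝ (y k) (K (x i) (x j) (y l))

/-- The tensor as an `n² × n²` block matrix: the `(s, t)` entry of the block `(i, j)`, that is the
entry in row `(i, s)` and column `(j, t)`, is `⟨y j, K (x i) (x s) (y t)⟩`. -/
def blockM (K : X → X → Y →L[ℝ] Y) (x : Fin n → X) (y : Fin n → Y) :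
    Matrix (Fin n × Fin n) (Fin n × Fin n) ℝ :=
  Matrix.of fun p q => tensorM K x y p.1 p.2 q.1 q.2

/-- The finite-dimensional dual objective
`∑ᵢ Lᵢ(Ωᵢ, K^Y) + 1/(2Λn) Tr(M̃ᵀ (Ω ⊗ Ω))`. -/
def dualObj (K : X → X → Y →L[ℝ] Y) (lam : ℝ) (x : Fin n → X) (y : Fin n → Y)
    (L : Fin n → (Fin n → ℝ) → Matrix (Fin n) (Fin n) ℝ → EReal)
    (Om : Matrix (Fin n) (Fin n) ℝ) : EReal :=
  ∑ i, L i (Om i) (Matrix.gram ℝ y) +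
    ((1 / (2 * lam * n) * ((blockM K x y).transpose * (Om ⊗ₖ Om)).trace : ℝ) : EReal)

/-- The input Gram matrix of a scalar kernel. -/
def gramX (k : X → X → ℝ) (x : Fin n → X) : Matrix (Fin n) (Fin n) ℝ :=
  Matrix.of fun i j => k (x i) (x j)

/-- The matrix `⟨y i, A (y j)⟩`. -/
def gramY (A : Y →L[ℝ] Y) (y : Fin n → Y) : Matrix (Fin n) (Fin n) ℝ :=
  Matrix.of fun i j => inner ℝ (y i) (A (y j))

/-- The dual objective for sums of separable kernels,
`∑ᵢ Lᵢ(Ωᵢ, K^Y) + 1/(2Λn) ∑ₜ Tr(K^Xₜ Ω K^Yₜ Ωᵀ)`. -/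
def dualObjSep {T : ℕ} (k : Fin T → X → X → ℝ) (A : Fin T → Y →L[ℝ] Y) (lam : ℝ)
    (x : Fin n → X) (y : Fin n → Y)
    (L : Fin n → (Fin n → ℝ) → Matrix (Fin n) (Fin n) ℝ → EReal)
    (Om : Matrix (Fin n) (Fin n) ℝ) : EReal :=
  ∑ i, L i (Om i) (Matrix.gram ℝ y) +
    ((1 / (2 * lam * n) *
      ∑ t, (gramX (k t) x * Om * gramY (A t) y * Om.transpose).trace : ℝ) : EReal)

end OVK

end

/-! Fenchel duality with a quantitative gap. Write `h_Ω` for the function parametrised by `Ω`.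
Fenchel–Young at each `xᵢ` and completing the square bound the dual objective at `Ω` below by `-n ·
primalObj h + (Λn/2)‖h - h_Ω‖²` for every `h` (`coe_le_dualObj`). Conversely, some `h₀` and `Ω` give
a dual value at most `-n · primalObj h₀` (`exists_dualObj_le`). First-order optimality yields `aᵢ ∈
Y` with `Λn h₀ = ∑ᵢ K(·, xᵢ) aᵢ` and `-aᵢ` a subgradient of `ℓᵢ` at `h₀(xᵢ)`. Projecting each `aᵢ`
onto the span of the outputs increases neither the conjugates (FL₁) nor the norm (invariance), and
coordinates of the projections form `Ω`. Together the two bounds force `h_Ω = h₀` for every optimal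
`Ω`, and give uniqueness of the primal solution. -/

open Topology Filter

/-! ### Convex analysis in Banach and Hilbert spaces -/

/-- A real-valued convex lower semicontinuous function on a Banach space is continuous. -/
theorem ConvexOn.continuous_of_lowerSemicontinuous {E : Type*} [NormedAddCommGroup E]
    [NormedSpace ℝ E] [CompleteSpace E] {f : E → ℝ} (hf : ConvexOn ℝ Set.univ f)
    (hlsc : LowerSemicontinuous f) : Continuous f := by
  -- Baire: some closed sublevel set has interior, so `f` is bounded above near a point, which
  -- suffices for a convex function.
  have hcl : ∀ N : ℕ, IsClosed (f ⁻¹' Set.Iic (N : ℝ)) := fun N => hlsc.isClosed_preimage _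
  have hU : ⋃ N : ℕ, f ⁻¹' Set.Iic (N : ℝ) = Set.univ := by
    refine Set.eq_univ_of_forall fun u => Set.mem_iUnion.2 ?_
    exact exists_nat_ge (f u)
  obtain ⟨N, u, hu⟩ := nonempty_interior_of_iUnion_of_closed hcl hU
  rw [← continuousOn_univ]
  have hb : ∃ v ∈ Set.univ, (𝓝 v).IsBoundedUnder (· ≤ ·) f :=
    ⟨u, trivial, N, mem_interior_iff_mem_nhds.1 hu⟩
  exact ((hf.continuousOn_tfae isOpen_univ ⟨u, trivial⟩).out 3 1).1 hb

/-- An affine function on `E` lying below the composition of a convex continuous function `f` with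
a linear map factors through an affine minorant of `f`. -/
theorem ConvexOn.exists_affine_minorant_comp {E F : Type*} [AddCommGroup E] [Module ℝ E]
    [NormedAddCommGroup F] [NormedSpace ℝ F] {f : F → ℝ} (hf : ConvexOn ℝ Set.univ f)
    (hc : Continuous f) (A : E →ₗ[ℝ] F) (φ : E →ₗ[ℝ] ℝ) (c : ℝ)
    (hle : ∀ h, φ h + c ≤ f (A h)) :
    ∃ ψ : F →L[ℝ] ℝ, (∀ h, ψ (A h) = φ h) ∧ ∀ u, ψ u + c ≤ f u := by
  have hs₁ : Convex ℝ {p : F × ℝ | f p.1 < p.2} := by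
    simpa using hf.convex_strict_epigraph
  have hs₂ : IsOpen {p : F × ℝ | f p.1 < p.2} :=
    isOpen_lt (hc.comp continuous_fst) continuous_snd
  have ht : Convex ℝ (Set.range fun h => (A h, φ h + c)) := by
    rintro _ ⟨p, rfl⟩ _ ⟨q, rfl⟩ a b - - hab
    refine ⟨a • p + b • q, ?_⟩
    have : c = a * c + b * c := by rw [← add_mul, hab, one_mul]
    ext
    · simp
    · simp only [map_add, map_smul, smul_eq_mul, Prod.smul_mk, Prod.mk_add_mk]
      linarith
  -- Separate the strict epigraph of `f` from the graph of the affine function, carried into `F × ℝ`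
  -- by `A`.
  obtain ⟨g, r, hg₁, hg₂⟩ := geometric_hahn_banach_open hs₁ hs₂ ht (by
    rw [Set.disjoint_left]
    rintro _ hp ⟨h, rfl⟩
    exact (hle h).not_gt hp)
  set a : ℝ := g (0, 1) with ha
  set ψ₀ : F →L[ℝ] ℝ := g.comp (ContinuousLinearMap.inl ℝ F ℝ) with hψ₀
  have hg : ∀ u t, g (u, t) = ψ₀ u + a * t := by
    intro u t
    have : ((u, t) : F × ℝ) = (u, 0) + t • (0, 1) := by simp
    rw [this, map_add, map_smul, hψ₀, ha]
    simp [mul_comm]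
  have h0 : r ≤ a * c := by
    have := hg₂ _ (Set.mem_range_self 0)
    simpa [hg] using this
  -- The hyperplane is not vertical: the epigraph has a point directly above the graph point over
  -- `0`.
  have ha0 : a < 0 := by
    have h1 : g (0, f 0 + 1) < r := hg₁ (0, f 0 + 1) (by simp)
    have h2 : c ≤ f 0 := by simpa using hle 0
    rw [hg, map_zero, zero_add] at h1
    by_contra! h
    nlinarith
  have hane : a ≠ 0 := ha0.ne
  have hT : ∀ h, r ≤ ψ₀ (A h) + a * (φ h + c) := fun h => by
    have := hg₂ _ (Set.mem_range_self h)
    simpa [hg] using this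
  -- A linear form bounded below vanishes; otherwise scaling `h` would reach `r - a * c - 1`.
  have hlin : ∀ h, ψ₀ (A h) + a * φ h = 0 := by
    intro h
    by_contra hne
    have := hT (((r - a * c - 1) / (ψ₀ (A h) + a * φ h)) • h)
    simp only [map_smul, smul_eq_mul] at this
    have h3 : (r - a * c - 1) / (ψ₀ (A h) + a * φ h) * (ψ₀ (A h) + a * φ h) = r - a * c - 1 :=
      div_mul_cancel₀ _ hne
    linarith
  have hS : ∀ u, ψ₀ u + a * f u ≤ r := by
    intro u
    refine le_of_forall_pos_le_add fun ε hε => ?_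
    have h1 := hg₁ (u, f u + ε / -a) (by
      have : 0 < ε / -a := div_pos hε (by linarith)
      simpa using this)
    have h2 : a * (ε / -a) = -ε := by field_simp
    rw [hg] at h1
    linarith
  refine ⟨-a⁻¹ • ψ₀, fun h => ?_, fun u => ?_⟩
  · have := hlin h
    have h4 : ψ₀ (A h) = -a * φ h := by linarith
    simp only [_root_.smul_apply, smul_eq_mul, h4]
    field_simp
  · have h5 := hS u
    have h6 : a * (-a⁻¹ * ψ₀ u) = -ψ₀ u := by field_simp
    simp only [_root_.smul_apply, smul_eq_mul]
    have : a * f u ≤ a * (-a⁻¹ * ψ₀ u + c) := by rw [mul_add, h6]; linarith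
    exact (mul_le_mul_left_of_neg ha0).1 this

/-- A convex continuous function plus a positive multiple of the squared norm of a Hilbert space
has a minimiser, here characterised by the first-order optimality condition. -/
theorem ConvexOn.exists_forall_sub_inner_le {H : Type*} [NormedAddCommGroup H]
    [InnerProductSpace ℝ H] [CompleteSpace H] {g : H → ℝ} (hg : ConvexOn ℝ Set.univ g)
    (hc : Continuous g) {m : ℝ} (hm : 0 < m) :
    ∃ h₀, ∀ h, g h₀ - m * inner ℝ h₀ (h - h₀) ≤ g h := by
  set F : H → ℝ := fun h => g h + m / 2 * ‖h‖ ^ 2 with hF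
  have hFc : Continuous F := by fun_prop
  have hconv : ∀ a b : H, ∀ t : ℝ, 0 ≤ t → t ≤ 1 →
      F (a + t • (b - a)) ≤ (1 - t) * F a + t * F b - m / 2 * (t * (1 - t)) * ‖b - a‖ ^ 2 := by
    intro a b t ht0 ht1
    have h1 := hg.2 (Set.mem_univ a) (Set.mem_univ b) (sub_nonneg.2 ht1) ht0 (by ring)
    have h2 : (1 - t) • a + t • b = a + t • (b - a) := by module
    rw [h2] at h1
    have h3 : ‖a + t • (b - a)‖ ^ 2
        = (1 - t) * ‖a‖ ^ 2 + t * ‖b‖ ^ 2 - t * (1 - t) * ‖b - a‖ ^ 2 := by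
      simp only [← real_inner_self_eq_norm_sq, inner_add_left, inner_add_right, inner_sub_left,
        inner_sub_right, real_inner_smul_left, real_inner_smul_right, real_inner_comm a b]
      ring
    simp only [hF, h3]
    simp only [smul_eq_mul] at h1
    linarith
  have hbdd : BddBelow (Set.range F) := by
    -- Factoring through the zero map produces a subgradient of `g` at `0`.
    obtain ⟨ψ, -, hψ⟩ := hg.exists_affine_minorant_comp hc (0 : H →ₗ[ℝ] H) 0 (g 0) (by simp)
    refine ⟨g 0 - ‖ψ‖ ^ 2 / (2 * m), ?_⟩
    rintro _ ⟨h, rfl⟩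
    have h1 := hψ h
    have h2 : -(‖ψ‖ * ‖h‖) ≤ ψ h := by
      have := ψ.le_opNorm h
      rw [Real.norm_eq_abs] at this
      linarith [neg_abs_le (ψ h)]
    have h3 : 0 ≤ (‖ψ‖ - m * ‖h‖) ^ 2 / (2 * m) := by positivity
    have h4 : (‖ψ‖ - m * ‖h‖) ^ 2 / (2 * m)
        = ‖ψ‖ ^ 2 / (2 * m) - ‖ψ‖ * ‖h‖ + m / 2 * ‖h‖ ^ 2 := by field_simp; ring
    simp only [hF]
    linarith
  set μ := ⨅ h, F h with hμ
  have hμle : ∀ h, μ ≤ F h := fun h => ciInf_le hbdd h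
  have hmin : ∀ k : ℕ, ∃ h, F h < μ + 1 / ((k : ℝ) + 1) := fun k =>
    exists_lt_of_ciInf_lt (lt_add_of_pos_right _ Nat.one_div_pos_of_nat)
  choose s hs using hmin
  -- Strong convexity at the midpoint makes near-minimisers close, so minimising sequences are
  -- Cauchy.
  have hd : ∀ a b : H, ∀ ε : ℝ, F a ≤ μ + ε → F b ≤ μ + ε → dist a b ≤ √(8 / m * ε) := by
    intro a b ε h1 h2
    have h3 := hconv a b (1 / 2) (by norm_num) (by norm_num)
    have h4 := hμle (a + (1 / 2 : ℝ) • (b - a))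
    rw [dist_comm, dist_eq_norm]
    refine Real.le_sqrt_of_sq_le ?_
    have h5 : m * ‖b - a‖ ^ 2 ≤ 8 * ε := by nlinarith
    rw [div_mul_eq_mul_div, le_div_iff₀ hm]
    linarith
  have hlim1 : Tendsto (fun k : ℕ => 1 / ((k : ℝ) + 1)) atTop (𝓝 0) :=
    tendsto_one_div_add_atTop_nhds_zero_nat
  have hcau : CauchySeq s := by
    refine cauchySeq_of_le_tendsto_0 (fun k : ℕ => √(8 / m * (1 / ((k : ℝ) + 1)))) ?_ ?_
    · intro p q N hp hq
      have key : ∀ p, N ≤ p → F (s p) ≤ μ + 1 / ((N : ℝ) + 1) := fun p hp =>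
        (hs p).le.trans (by gcongr)
      exact hd _ _ _ (key p hp) (key q hq)
    · have := (hlim1.const_mul (8 / m)).sqrt
      simpa using this
  obtain ⟨h₀, hh₀⟩ := cauchySeq_tendsto_of_complete hcau
  have hF0 : ∀ h, F h₀ ≤ F h := by
    intro h
    refine le_trans ?_ (hμle h)
    refine le_of_tendsto_of_tendsto' ((hFc.tendsto h₀).comp hh₀)
      (by simpa using hlim1.const_add μ) fun k => (hs k).le
  refine ⟨h₀, fun h => ?_⟩
  -- Divide by `t` along the segment to `h`, then let `t → 0`: quadratic growth at `h₀`, whose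
  -- squared norms cancel to the first-order condition.
  have h1 : ∀ t : ℝ, 0 < t → t ≤ 1 →
      F h₀ + m / 2 * (1 - t) * ‖h - h₀‖ ^ 2 ≤ F h := by
    intro t ht0 ht1
    have h2 := hconv h₀ h t ht0.le ht1
    have h3 := hF0 (h₀ + t • (h - h₀))
    have h4 : t * (F h₀ + m / 2 * (1 - t) * ‖h - h₀‖ ^ 2) ≤ t * F h := by linarith
    exact le_of_mul_le_mul_left h4 ht0
  have h2 : F h₀ + m / 2 * ‖h - h₀‖ ^ 2 ≤ F h := by
    have ht : Tendsto (fun t : ℝ => F h₀ + m / 2 * (1 - t) * ‖h - h₀‖ ^ 2) (𝓝[>] 0)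
        (𝓝 (F h₀ + m / 2 * (1 - 0) * ‖h - h₀‖ ^ 2)) :=
      (Continuous.tendsto (by fun_prop) 0).mono_left nhdsWithin_le_nhds
    rw [sub_zero, mul_one] at ht
    refine le_of_tendsto ht ?_
    filter_upwards [Ioc_mem_nhdsGT (zero_lt_one' ℝ)] with t ht using h1 t ht.1 ht.2
  have h3 : ‖h - h₀‖ ^ 2 = ‖h‖ ^ 2 - ‖h₀‖ ^ 2 - 2 * inner ℝ h₀ (h - h₀) := by
    simp only [← real_inner_self_eq_norm_sq, inner_sub_left, inner_sub_right,
      real_inner_comm h h₀]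
    ring
  simp only [hF] at h2
  rw [h3] at h2
  linarith

namespace OVK

theorem coe_sum_ereal {ι : Type*} (s : Finset ι) (f : ι → ℝ) :
    ((∑ i ∈ s, f i : ℝ) : EReal) = ∑ i ∈ s, (f i : EReal) :=
  map_sum (⟨⟨Real.toEReal, EReal.coe_zero⟩, EReal.coe_add⟩ : ℝ →+ EReal) f s

/-! ### Fenchel–Young inequality -/

section Fenchel

variable {Y : Type*} [NormedAddCommGroup Y] [InnerProductSpace ℝ Y]

theorem fenchel_le_coe_iff {f : Y → ℝ} {a : Y} {c : ℝ} :
    fenchel f a ≤ (c : EReal) ↔ ∀ u, inner ℝ a u - f u ≤ c := by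
  simp only [fenchel, iSup_le_iff, EReal.coe_le_coe_iff]

theorem coe_le_fenchel (f : Y → ℝ) (a u : Y) :
    ((inner ℝ a u - f u : ℝ) : EReal) ≤ fenchel f a :=
  le_iSup (fun u : Y => ((inner ℝ a u - f u : ℝ) : EReal)) u

end Fenchel

/-! ### Duality in the vv-RKHS -/

section Representer

variable {X Y H : Type*} [NormedAddCommGroup Y] [InnerProductSpace ℝ Y] [CompleteSpace Y]
  [NormedAddCommGroup H] [InnerProductSpace ℝ H] [CompleteSpace H] [RKHS ℝ H X Y]
  {n : ℕ}

/-- The element `∑ᵢ K(·, xᵢ) aᵢ` of the vv-RKHS. -/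
noncomputable def kernelComb (H : Type*) [NormedAddCommGroup H] [InnerProductSpace ℝ H] [CompleteSpace H]
    [RKHS ℝ H X Y] (x : Fin n → X) (a : Fin n → Y) : H :=
  ∑ i, RKHS.kerFun H (x i) (a i)

theorem inner_kernelComb (x : Fin n → X) (a : Fin n → Y) (h : H) :
    inner ℝ (kernelComb H x a) h = ∑ i, inner ℝ (a i) (h (x i)) := by
  simp [kernelComb, sum_inner]

theorem inner_kernelComb_kernelComb {K : X → X → Y →L[ℝ] Y}
    (hH : ∀ s t : X, RKHS.kernel H s t = K s t) (x : Fin n → X) (a b : Fin n → Y) :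
    inner ℝ (kernelComb H x a) (kernelComb H x b)
      = ∑ i, ∑ j, inner ℝ (a i) (K (x i) (x j) (b j)) := by
  rw [inner_kernelComb]
  refine Finset.sum_congr rfl fun i _ => ?_
  rw [← inner_sum, kernelComb, ← RKHS.coeCLM_apply, map_sum, Finset.sum_apply]
  simp [RKHS.kerFun_apply, hH]

theorem kernelComb_apply {K : X → X → Y →L[ℝ] Y}
    (hH : ∀ s t : X, RKHS.kernel H s t = K s t) (x : Fin n → X) (a : Fin n → Y) (s : X) :
    kernelComb H x a s = ∑ i, K s (x i) (a i) := by
  rw [kernelComb, ← RKHS.coeCLM_apply, map_sum, Finset.sum_apply]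
  simp [RKHS.kerFun_apply, hH]

omit [CompleteSpace Y] in
theorem trace_blockM_mul_kronecker (K : X → X → Y →L[ℝ] Y) (x : Fin n → X) (y : Fin n → Y)
    (Om : Matrix (Fin n) (Fin n) ℝ) :
    ((blockM K x y).transpose * (Om ⊗ₖ Om)).trace
      = ∑ i, ∑ s, ∑ j, ∑ t, tensorM K x y i s j t * (Om i j * Om s t) := by
  rw [Matrix.trace_mul_comm]
  simp only [Matrix.trace, Matrix.diag, Matrix.mul_apply, Matrix.transpose_apply, blockM,
    Matrix.of_apply, Matrix.kroneckerMap_apply, Fintype.sum_prod_type, mul_comm]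

theorem trace_blockM_mul_kronecker_eq_norm_sq {K : X → X → Y →L[ℝ] Y}
    (hH : ∀ s t : X, RKHS.kernel H s t = K s t) (x : Fin n → X) (y : Fin n → Y)
    (Om : Matrix (Fin n) (Fin n) ℝ) :
    ((blockM K x y).transpose * (Om ⊗ₖ Om)).trace
      = ‖kernelComb H x fun i => ∑ j, Om i j • y j‖ ^ 2 := by
  rw [← real_inner_self_eq_norm_sq, inner_kernelComb_kernelComb hH]
  rw [trace_blockM_mul_kronecker]
  refine Finset.sum_congr rfl fun i _ => Finset.sum_congr rfl fun s _ => ?_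
  simp only [tensorM, map_sum, map_smul, sum_inner, inner_sum, real_inner_smul_left,
    real_inner_smul_right]
  rw [Finset.sum_comm]
  exact Finset.sum_congr rfl fun j _ => Finset.sum_congr rfl fun t _ => by ring

/-- The optimality condition in `H` is an affine minorant of the total loss composed with evaluation
at the `xᵢ`. It factors through `Yⁿ`, and Riesz in each coordinate gives the `-aᵢ`. -/
theorem exists_dual_certificate (l : Fin n → Y → ℝ) (hconv : ∀ i, ConvexOn ℝ Set.univ (l i))
    (hcont : ∀ i, Continuous (l i)) (x : Fin n → X) {m : ℝ} (hm : 0 < m) :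
    ∃ (h₀ : H) (a : Fin n → Y), m • h₀ = kernelComb H x a ∧
      ∀ i u, inner ℝ (-a i) u - l i u ≤ inner ℝ (-a i) (h₀ (x i)) - l i (h₀ (x i)) := by
  set f : (Fin n → Y) → ℝ := fun u => ∑ i, l i (u i) with hf
  have hfc : Continuous f :=
    continuous_finsetSum _ fun i _ => (hcont i).comp (continuous_apply i)
  have hfconv : ConvexOn ℝ Set.univ f := by
    refine ⟨convex_univ, fun u _ v _ a b ha hb hab => ?_⟩
    simp only [hf, smul_eq_mul, Finset.mul_sum, ← Finset.sum_add_distrib]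
    exact Finset.sum_le_sum fun i _ => (hconv i).2 trivial trivial ha hb hab
  set A : H →L[ℝ] (Fin n → Y) :=
    ContinuousLinearMap.pi fun i => (RKHS.kerFun H (x i)).adjoint with hA
  have hAi : ∀ h i, A h i = h (x i) := by simp [hA]
  obtain ⟨h₀, hh₀⟩ := (hfconv.comp_linearMap A.toLinearMap).exists_forall_sub_inner_le
    (hfc.comp A.continuous) hm
  obtain ⟨ψ, hψ₁, hψ₂⟩ := hfconv.exists_affine_minorant_comp hfc A.toLinearMap
    (-m • innerSL ℝ h₀ : H →L[ℝ] ℝ).toLinearMap (f (A h₀) + m * inner ℝ h₀ h₀) (by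
      intro h
      have := hh₀ h
      simp [inner_sub_right] at this ⊢
      linarith)
  set a : Fin n → Y := fun i => -(InnerProductSpace.toDual ℝ Y).symm
    (ψ.comp (ContinuousLinearMap.single ℝ (fun _ => Y) i)) with ha
  have hψ : ∀ u, ψ u = ∑ i, inner ℝ (-a i) (u i) := by
    intro u
    conv_lhs => rw [← Finset.univ_sum_single u]
    simp [ha]
  have hψA : ∀ h, ψ (A h) = -m * inner ℝ h₀ h := by simpa using hψ₁
  refine ⟨h₀, a, ?_, fun i u => ?_⟩
  · refine ext_inner_right ℝ fun h => ?_
    have := hψA h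
    rw [hψ] at this
    simp only [hAi, inner_neg_left, Finset.sum_neg_distrib] at this
    rw [inner_kernelComb, real_inner_smul_left]
    linarith
  -- Varying only coordinate `i` splits the joint subgradient inequality into one per loss.
  · have h1 := hψ₂ (Function.update (A h₀) i u)
    have h2 := hψA h₀
    have h3 : ∑ j, (inner ℝ (-a j) (Function.update (A h₀) i u j)
        - l j (Function.update (A h₀) i u j))
        ≤ ∑ j, (inner ℝ (-a j) (A h₀ j) - l j (A h₀ j)) := by
      simp only [Finset.sum_sub_distrib, ← hψ]
      simp only [hf] at h1
      linarith
    rw [← Finset.add_sum_erase _ _ (Finset.mem_univ i),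
      ← Finset.add_sum_erase (a := i) _ (fun j => inner ℝ (-a j) (A h₀ j) - l j (A h₀ j))
        (Finset.mem_univ i)] at h3
    have h4 : ∑ j ∈ Finset.univ.erase i, (inner ℝ (-a j) (Function.update (A h₀) i u j)
        - l j (Function.update (A h₀) i u j))
        = ∑ j ∈ Finset.univ.erase i, (inner ℝ (-a j) (A h₀ j) - l j (A h₀ j)) :=
      Finset.sum_congr rfl fun j hj => by
        rw [Function.update_of_ne (Finset.ne_of_mem_erase hj)]
    rw [h4, Function.update_self, hAi] at h3
    linarith

/-- Replacing the coefficients by their projections on the span of the outputs does not increase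
the norm. -/
theorem exists_mem_outSpan_norm_kernelComb_le {K : X → X → Y →L[ℝ] Y}
    (hH : ∀ s t : X, RKHS.kernel H s t = K s t) {x : Fin n → X} {y : Fin n → Y}
    (hinv : LeavesSpanInvariant K x y) (a : Fin n → Y) :
    ∃ p b : Fin n → Y, a = p + b ∧ (∀ i, p i ∈ outSpan y) ∧ (∀ i, b i ∈ (outSpan y)ᗮ) ∧
      ‖kernelComb H x p‖ ^ 2 ≤ ‖kernelComb H x a‖ ^ 2 := by
  have : FiniteDimensional ℝ (outSpan y) :=
    FiniteDimensional.span_of_finite ℝ (Set.finite_range y)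
  choose p hp b hb hpb using fun i => (outSpan y).exists_add_mem_mem_orthogonal (a i)
  have hab : a = p + b := funext hpb
  refine ⟨p, b, hab, hp, hb, ?_⟩
  have h1 : kernelComb H x a = kernelComb H x p + kernelComb H x b := by
    simp [kernelComb, hab, Finset.sum_add_distrib]
  -- Invariance keeps `K(xᵢ, xⱼ) pⱼ` in the span, orthogonal to `bᵢ`.
  have h2 : inner ℝ (kernelComb H x b) (kernelComb H x p) = 0 := by
    rw [inner_kernelComb_kernelComb hH]
    refine Finset.sum_eq_zero fun i _ => Finset.sum_eq_zero fun j _ => ?_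
    exact Submodule.inner_left_of_mem_orthogonal (hinv i j _ (hp j)) (hb i)
  rw [h1, norm_add_sq_real, real_inner_comm, h2]
  nlinarith [sq_nonneg ‖kernelComb H x b‖]

omit [CompleteSpace Y] [CompleteSpace H] in
theorem natCast_mul_primalObj (hn : 0 < n) (l : Y → Y → ℝ) (lam : ℝ) (x : Fin n → X)
    (y : Fin n → Y) (h : H) :
    n * primalObj l lam x y h = ∑ i, l (h (x i)) (y i) + lam * n / 2 * ‖h‖ ^ 2 := by
  have : (n : ℝ) ≠ 0 := by positivity
  rw [primalObj]
  field_simp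

theorem dualObj_eq {K : X → X → Y →L[ℝ] Y} (hH : ∀ s t : X, RKHS.kernel H s t = K s t)
    (lam : ℝ) (x : Fin n → X) (y : Fin n → Y) {l : Y → Y → ℝ}
    {L : Fin n → (Fin n → ℝ) → Matrix (Fin n) (Fin n) ℝ → EReal} (hFL2 : FL2 l y L)
    (Om : Matrix (Fin n) (Fin n) ℝ) :
    dualObj K lam x y L Om = ∑ i, fenchel (fun u => l u (y i)) (-∑ j, Om i j • y j) +
      ((1 / (2 * lam * n) * ‖kernelComb H x fun i => ∑ j, Om i j • y j‖ ^ 2 : ℝ) : EReal) := by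
  simp only [dualObj, trace_blockM_mul_kronecker_eq_norm_sq hH, hFL2 _ _]

/-- Weak duality, with the gap bounded below by the distance to the function parametrised by the
dual variable. -/
theorem coe_le_dualObj (hn : 0 < n) {K : X → X → Y →L[ℝ] Y}
    (hH : ∀ s t : X, RKHS.kernel H s t = K s t) {lam : ℝ} (hlam : 0 < lam) (x : Fin n → X)
    (y : Fin n → Y) {l : Y → Y → ℝ}
    {L : Fin n → (Fin n → ℝ) → Matrix (Fin n) (Fin n) ℝ → EReal} (hFL2 : FL2 l y L)
    (Om : Matrix (Fin n) (Fin n) ℝ) (h : H) :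
    ((-(n * primalObj l lam x y h) + lam * n / 2 *
      ‖h - (1 / (lam * n)) • kernelComb H x fun i => ∑ j, Om i j • y j‖ ^ 2 : ℝ) : EReal)
      ≤ dualObj K lam x y L Om := by
  rw [dualObj_eq hH lam x y hFL2]
  set a : Fin n → Y := fun i => ∑ j, Om i j • y j
  have hn' : (0 : ℝ) < n := by positivity
  have h1 : ((∑ i, (inner ℝ (-a i) (h (x i)) - l (h (x i)) (y i)) : ℝ) : EReal)
      ≤ ∑ i, fenchel (fun u => l u (y i)) (-a i) := by
    rw [coe_sum_ereal]
    exact Finset.sum_le_sum fun i _ => coe_le_fenchel (fun u => l u (y i)) _ (h (x i))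
  -- Fenchel–Young is the only loss; the rest is an identity by completing the square.
  refine le_trans (le_of_eq ?_) (add_le_add_left h1 _)
  rw [← EReal.coe_add, EReal.coe_eq_coe_iff, natCast_mul_primalObj hn, norm_sub_sq_real,
    real_inner_smul_right, norm_smul, mul_pow, Real.norm_eq_abs, sq_abs, real_inner_comm,
    inner_kernelComb, Finset.sum_sub_distrib]
  simp only [inner_neg_left, Finset.sum_neg_distrib]
  field_simp
  ring

/-- Strong duality. -/
theorem exists_dualObj_le (hn : 0 < n) {K : X → X → Y →L[ℝ] Y}
    (hH : ∀ s t : X, RKHS.kernel H s t = K s t) {lam : ℝ} (hlam : 0 < lam) (x : Fin n → X)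
    (y : Fin n → Y) {l : Y → Y → ℝ}
    (hconv : ∀ i, ConvexOn ℝ Set.univ (fun u => l u (y i)))
    (hcont : ∀ i, Continuous (fun u => l u (y i)))
    {L : Fin n → (Fin n → ℝ) → Matrix (Fin n) (Fin n) ℝ → EReal} (hFL1 : FL1 l y)
    (hFL2 : FL2 l y L) (hinv : LeavesSpanInvariant K x y) :
    ∃ (h₀ : H) (Om : Matrix (Fin n) (Fin n) ℝ),
      dualObj K lam x y L Om ≤ ((-(n * primalObj l lam x y h₀) : ℝ) : EReal) := by
  have hn' : (0 : ℝ) < n := by positivity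
  obtain ⟨h₀, a, hha, hsub⟩ := exists_dual_certificate (H := H) (fun i u => l u (y i)) hconv hcont x
    (mul_pos hlam hn')
  obtain ⟨p, b, hab, hp, hb, hnorm⟩ := exists_mem_outSpan_norm_kernelComb_le hH hinv a
  choose w hOm using fun i => (Submodule.mem_span_range_iff_exists_fun ℝ).1 (hp i)
  refine ⟨h₀, Matrix.of w, ?_⟩
  rw [dualObj_eq hH lam x y hFL2]
  simp only [Matrix.of_apply, hOm]
  have h1 : ∑ i, fenchel (fun u => l u (y i)) (-p i)
      ≤ ((∑ i, (inner ℝ (-a i) (h₀ (x i)) - l (h₀ (x i)) (y i)) : ℝ) : EReal) := by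
    rw [coe_sum_ereal]
    refine Finset.sum_le_sum fun i _ => ?_
    refine (hFL1 i _ (neg_mem (hp i)) _ (neg_mem (hb i))).trans ?_
    rw [← neg_add, ← Pi.add_apply, ← hab]
    exact fenchel_le_coe_iff.2 (hsub i)
  refine (add_le_add_left h1 _).trans ?_
  rw [← EReal.coe_add, EReal.coe_le_coe_iff, natCast_mul_primalObj hn, Finset.sum_sub_distrib]
  have h2 : ∑ i, inner ℝ (-a i) (h₀ (x i)) = -(lam * n * ‖h₀‖ ^ 2) := by
    simp only [inner_neg_left, Finset.sum_neg_distrib]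
    rw [← inner_kernelComb, ← hha, real_inner_smul_left, real_inner_self_eq_norm_sq]
  have h3 : ‖kernelComb H x a‖ ^ 2 = (lam * n) ^ 2 * ‖h₀‖ ^ 2 := by
    rw [← hha, norm_smul, mul_pow, Real.norm_eq_abs, sq_abs]
  have h4 : 1 / (2 * lam * n) * ‖kernelComb H x p‖ ^ 2 ≤ lam * n / 2 * ‖h₀‖ ^ 2 := by
    calc 1 / (2 * lam * n) * ‖kernelComb H x p‖ ^ 2
        ≤ 1 / (2 * lam * n) * ((lam * n) ^ 2 * ‖h₀‖ ^ 2) := by rw [← h3]; gcongr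
      _ = lam * n / 2 * ‖h₀‖ ^ 2 := by field_simp
  change 1 / (2 * lam * n) * ‖kernelComb H x fun i => p i‖ ^ 2 ≤ _ at h4
  rw [h2]
  linarith

end Representer

/-! ### Sums of separable kernels -/

section Separable

variable {X Y : Type*} [NormedAddCommGroup Y] [InnerProductSpace ℝ Y] {n T : ℕ}
  {K : X → X → Y →L[ℝ] Y} {k : Fin T → X → X → ℝ} {A : Fin T → Y →L[ℝ] Y}

theorem tensorM_eq_sum (hK : ∀ s s', K s s' = ∑ t, k t s s' • A t) (x : Fin n → X)
    (y : Fin n → Y) (i j p q : Fin n) :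
    tensorM K x y i j p q = ∑ t, gramX (k t) x i j * gramY (A t) y p q := by
  simp [tensorM, hK, gramX, gramY, inner_sum,
    real_inner_smul_right]

theorem trace_blockM_mul_kronecker_eq_sum (hK : ∀ s s', K s s' = ∑ t, k t s s' • A t)
    (hA : ∀ t, (A t).IsPositive) (x : Fin n → X) (y : Fin n → Y)
    (Om : Matrix (Fin n) (Fin n) ℝ) :
    ((blockM K x y).transpose * (Om ⊗ₖ Om)).trace
      = ∑ t, (gramX (k t) x * Om * gramY (A t) y * Om.transpose).trace := by
  rw [trace_blockM_mul_kronecker]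
  -- The trace produces the output Gram entries with indices swapped relative to the tensor.
  have hsymm : ∀ t p q, gramY (A t) y p q = gramY (A t) y q p := fun t p q => by
    simp only [gramY, Matrix.of_apply]
    rw [real_inner_comm]
    exact (hA t).isSymmetric (y q) (y p)
  simp only [tensorM_eq_sum hK, Matrix.trace, Matrix.diag, Matrix.mul_apply,
    Matrix.transpose_apply, Finset.sum_mul]
  rw [Finset.sum_comm (s := (Finset.univ : Finset (Fin T)))]
  refine Finset.sum_congr rfl fun i _ => ?_
  simp only [fun s j => Finset.sum_comm (s := (Finset.univ : Finset (Fin n)))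
    (t := (Finset.univ : Finset (Fin T)))
    (f := fun t u => gramX (k u) x i s * gramY (A u) y j t * (Om i j * Om s t))]
  simp only [Finset.sum_comm (s := (Finset.univ : Finset (Fin n)))
    (t := (Finset.univ : Finset (Fin T)))]
  refine Finset.sum_congr rfl fun u _ => ?_
  rw [Finset.sum_comm]
  refine Finset.sum_congr rfl fun j _ => ?_
  rw [Finset.sum_comm]
  refine Finset.sum_congr rfl fun t _ => Finset.sum_congr rfl fun s _ => ?_
  rw [hsymm u t j]
  ring

end Separable

end OVK

/-! ### Conclusion from the two duality bounds -/

theorem mainTheorem1 {X Y H : Type*}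
    [NormedAddCommGroup Y] [InnerProductSpace ℝ Y] [CompleteSpace Y]
    [NormedAddCommGroup H] [InnerProductSpace ℝ H] [CompleteSpace H] [RKHS ℝ H X Y]
    (K : X → X → Y →L[ℝ] Y) (hK : OVK.IsOVK K)
    (hH : ∀ s t : X, RKHS.kernel H s t = K s t)
    {n : ℕ} (hn : 0 < n) (x : Fin n → X) (y : Fin n → Y)
    (l : Y → Y → ℝ)
    (hconv : ∀ i, ConvexOn ℝ Set.univ (fun u => l u (y i)))
    (hlsc : ∀ i, LowerSemicontinuous (fun u => l u (y i)))
    (lam : ℝ) (hlam : 0 < lam)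
    (L : Fin n → (Fin n → ℝ) → Matrix (Fin n) (Fin n) ℝ → EReal)
    (hFL1 : OVK.FL1 l y) (hFL2 : OVK.FL2 l y L)
    (hinv : OVK.LeavesSpanInvariant K x y) :
    (∃ hhat : H,
      (∀ h : H, IsMinOn (OVK.primalObj (H := H) l lam x y) Set.univ h ↔ h = hhat) ∧
      (∃ Om : Matrix (Fin n) (Fin n) ℝ,
        IsMinOn (OVK.dualObj K lam x y L) Set.univ Om ∧ OVK.dualObj K lam x y L Om ≠ ⊤) ∧
      (∀ Om : Matrix (Fin n) (Fin n) ℝ,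
        IsMinOn (OVK.dualObj K lam x y L) Set.univ Om →
          ∀ s : X, hhat s =
            (1 / (lam * n)) • ∑ i, ∑ j, K s (x i) (Om i j • y j))) ∧
    (∀ (T : ℕ) (k : Fin T → X → X → ℝ) (A : Fin T → Y →L[ℝ] Y),
      OVK.IsSumOfSeparable K k A →
        (∀ i j p q, OVK.tensorM K x y i j p q =
          ∑ t, OVK.gramX (k t) x i j * OVK.gramY (A t) y p q) ∧
        (∀ Om : Matrix (Fin n) (Fin n) ℝ,
          OVK.dualObj K lam x y L Om = OVK.dualObjSep k A lam x y L Om)) := by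
  refine ⟨?_, fun T k A hS => ⟨OVK.tensorM_eq_sum hS.eq_sum x y, fun Om => ?_⟩⟩
  · have hcont i : Continuous fun u => l u (y i) :=
      (hconv i).continuous_of_lowerSemicontinuous (hlsc i)
    have hn' : (0 : ℝ) < n := by positivity
    have hm : 0 < lam * n / 2 := by positivity
    obtain ⟨h₀, Om₀, hle⟩ :=
      OVK.exists_dualObj_le (H := H) hn hH hlam x y hconv hcont hFL1 hFL2 hinv
    have hweak := OVK.coe_le_dualObj (H := H) hn hH hlam x y hFL2
    have hgap (Om : Matrix (Fin n) (Fin n) ℝ)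
        (hOm : OVK.dualObj K lam x y L Om ≤ ((-(n * OVK.primalObj l lam x y h₀) : ℝ) : EReal))
        (h : H) : lam * n / 2 * ‖h - (1 / (lam * n)) • OVK.kernelComb H x
          fun i => ∑ j, Om i j • y j‖ ^ 2 + n * OVK.primalObj l lam x y h₀
          ≤ n * OVK.primalObj l lam x y h := by
      have := EReal.coe_le_coe_iff.1 ((hweak Om h).trans hOm)
      linarith
    -- Taking `h = h₀` in the gap leaves only the squared distance.
    have hrep (Om : Matrix (Fin n) (Fin n) ℝ)
        (hOm : OVK.dualObj K lam x y L Om ≤ ((-(n * OVK.primalObj l lam x y h₀) : ℝ) : EReal)) :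
        h₀ = (1 / (lam * n)) • OVK.kernelComb H x fun i => ∑ j, Om i j • y j := by
      have h1 := hgap Om hOm h₀
      have h2 : ‖h₀ - (1 / (lam * n)) • OVK.kernelComb H x fun i => ∑ j, Om i j • y j‖ ^ 2 ≤ 0 :=
        nonpos_of_mul_nonpos_right (by linarith) hm
      exact sub_eq_zero.1 (norm_eq_zero.1 (pow_eq_zero_iff two_ne_zero |>.1
        (le_antisymm h2 (sq_nonneg _))))
    have hprimal (h : H) : lam * n / 2 * ‖h - h₀‖ ^ 2 + n * OVK.primalObj l lam x y h₀
        ≤ n * OVK.primalObj l lam x y h := by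
      have := hgap Om₀ hle h
      rwa [← hrep Om₀ hle] at this
    refine ⟨h₀, fun h => ⟨fun hmin => ?_, ?_⟩, ⟨Om₀, fun Om _ => ?_, ?_⟩, fun Om hmin s => ?_⟩
    · have h1 : OVK.primalObj l lam x y h ≤ OVK.primalObj l lam x y h₀ := hmin (Set.mem_univ h₀)
      have h2 : ‖h - h₀‖ ^ 2 ≤ 0 :=
        nonpos_of_mul_nonpos_right (by nlinarith [hprimal h]) hm
      exact sub_eq_zero.1 (norm_eq_zero.1 (pow_eq_zero_iff two_ne_zero |>.1
        (le_antisymm h2 (sq_nonneg _))))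
    · rintro rfl g -
      refine le_of_mul_le_mul_left ?_ hn'
      have : 0 ≤ lam * n / 2 * ‖g - h‖ ^ 2 := by positivity
      linarith [hprimal g]
    · refine hle.trans ((EReal.coe_le_coe_iff.2 ?_).trans (hweak Om h₀))
      exact le_add_of_nonneg_right (by positivity)
    · exact (hle.trans_lt (EReal.coe_lt_top _)).ne
    · have h1 := hrep Om ((hmin (Set.mem_univ Om₀)).trans hle)
      conv_lhs => rw [h1]
      rw [RKHS.coe_smul, Pi.smul_apply, OVK.kernelComb_apply hH]
      simp only [map_sum]
  · simp only [OVK.dualObj, OVK.dualObjSep,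
      OVK.trace_blockM_mul_kronecker_eq_sum hS.eq_sum hS.pos]
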